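/- All graphs are finite, simple and undirected, $\mathrm{d}_\Gamma(u,v)$ denotes distance in a graph $\Gamma$, and $\log$ is the natural logarithm. A set $R$ of vertices of $\Gamma$ is *resolving* if for any two distinct vertices $u,w$ there is $v\in R$ with $\mathrm{d}_\Gamma(u,v)\neq \mathrm{d}_\Gamma(w,v)$; the *metric dimension* $\mu(\Gamma)$ is the smallest size of a resolving set. A connected graph $\Gamma$ is *distance-regular* if, for all vertices $u,v$, the numbers of neighbours of $v$ at distances $i-1$, $i$, $i+1$ from $u$, where $i=\mathrm{d}_\Gamma(u,v)$, depend only on $i$. A distance-regular graph $\Gamma$ of diameter $d$ is *primitive* if for every $0<i\le d$ the graph on the same vertices in which $u,v$ are adjacent when $\mathrm{d}_\Gamma(u,v)=i$ is connected. It is *$t$-antipodal* if being at distance $0$ or $d$ is an equivalence relation on the vertices all of whose classes (the antipodal classes) have size $t$; the *folded graph* $\overline{\Gamma}$ (which is again distance-regular when $d\ge 3$) then has the antipodal classes as its vertices, two distinct classes being adjacent if and only if they contain adjacent vertices of $\Gamma$. Let $M(\overline\Gamma)$ be the maximum size of a set of vertices at a given distance from any vertex of $\overline\Gamma$, that is,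 $M(\overline\Gamma)=\max_{v,i}|\{w : \mathrm{d}_{\overline\Gamma}(v,w)=i\}|$. Suppose $\Gamma$ is a $t$-antipodal distance-regular graph with $n$ vertices and diameter $d\geq 4$ whose folded graph $\overline{\Gamma}$ is primitive and has diameter $\bar d\geq 2$. Then (i) $\displaystyle \mu(\Gamma) < (t-1)\left(4\sqrt{n/t}\,\log(n/t)+1\right)$; (ii) $\displaystyle \mu(\Gamma) < (t-1)\left(2\bar d\,\frac{n}{n-tM(\overline{\Gamma})}\,\log(n/t)+1\right)$. -/

import Mathlib

namespace SimpleGraph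

/-- A set `S` of vertices is resolving if distinct vertices are told apart by their distances
to the members of `S`. -/
def IsResolving {V : Type*} (Γ : SimpleGraph V) (S : Finset V) : Prop :=
  ∀ u w : V, (∀ s ∈ S, Γ.dist u s = Γ.dist w s) → u = w

/-- The metric dimension: the smallest size of a resolving set. -/
noncomputable def metricDimension {V : Type*} (Γ : SimpleGraph V) : ℕ :=
  sInf {m : ℕ | ∃ S : Finset V, Γ.IsResolving S ∧ S.card = m}

/-- A connected graph is distance-regular if for all vertices `u`, `v` the numbers `c`, `a`, `b` of
neighbours of `v` at distance `i - 1`, `i`, `i + 1` from `u`, where `i` is the distance from `u`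
to `v`, depend only on `i`. -/
def IsDistanceRegular {V : Type*} (Γ : SimpleGraph V) : Prop :=
  Γ.Connected ∧ ∃ c a b : ℕ → ℕ, ∀ u v : V,
    {w | Γ.Adj v w ∧ Γ.dist u w + 1 = Γ.dist u v}.ncard = c (Γ.dist u v) ∧
    {w | Γ.Adj v w ∧ Γ.dist u w = Γ.dist u v}.ncard = a (Γ.dist u v) ∧
    {w | Γ.Adj v w ∧ Γ.dist u w = Γ.dist u v + 1}.ncard = b (Γ.dist u v)

/-- The distance-`i` graph: two distinct vertices are adjacent if their distance is `i`. -/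
def distanceGraph {V : Type*} (Γ : SimpleGraph V) (i : ℕ) : SimpleGraph V where
  Adj u v := u ≠ v ∧ Γ.dist u v = i
  symm := ⟨fun _ _ h => ⟨h.1.symm, by rw [dist_comm]; exact h.2⟩⟩
  loopless := ⟨fun _ h => h.1 rfl⟩

/-- The primitivity condition: the distance-`i` graphs, `0 < i ≤ diam`, are all connected. -/
def IsPrimitive {V : Type*} (Γ : SimpleGraph V) : Prop :=
  ∀ i : ℕ, 0 < i → i ≤ Γ.diam → (Γ.distanceGraph i).Connected

/-- The relation of being at distance `0` or `diam`. -/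
def AntipodalRel {V : Type*} (Γ : SimpleGraph V) (u v : V) : Prop :=
  Γ.dist u v = 0 ∨ Γ.dist u v = Γ.diam

/-- `Γ` is `t`-antipodal: being at distance `0` or `diam` is an equivalence relation all of whose
classes have size `t`. -/
structure IsAntipodal {V : Type*} (Γ : SimpleGraph V) (t : ℕ) : Prop where
  equivalence : Equivalence Γ.AntipodalRel
  ncard_class : ∀ v : V, {w | Γ.AntipodalRel v w}.ncard = t

/-- The setoid of antipodal classes. -/
def IsAntipodal.setoid {V : Type*} {Γ : SimpleGraph V} {t : ℕ} (h : Γ.IsAntipodal t) : Setoid V :=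
  ⟨Γ.AntipodalRel, h.equivalence⟩

/-- The folded graph: its vertices are the antipodal classes, and two distinct classes are adjacent
if they contain adjacent vertices. -/
def IsAntipodal.foldedGraph {V : Type*} {Γ : SimpleGraph V} {t : ℕ} (h : Γ.IsAntipodal t) :
    SimpleGraph (Quotient h.setoid) where
  Adj C D := C ≠ D ∧
    ∃ u v : V, Quotient.mk h.setoid u = C ∧ Quotient.mk h.setoid v = D ∧ Γ.Adj u v
  symm := ⟨fun _ _ ⟨hne, u, v, hu, hv, huv⟩ => ⟨hne.symm, v, u, hv, hu, huv.symm⟩⟩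
  loopless := ⟨fun _ h => h.1 rfl⟩

/-- The maximum size of a set of vertices at a given distance from any vertex (of a finite
graph). -/
noncomputable def maxDistanceClass {V : Type*} (Γ : SimpleGraph V) : ℕ :=
  sSup {m : ℕ | ∃ (v : V) (i : ℕ), {w | Γ.dist v w = i}.ncard = m}

end SimpleGraph

/-!
In an antipodal distance-regular graph `Γ` two antipodal vertices have equal or complementary
distances to any third vertex, so distances in the folded graph are `min k (diam - k)`. If two
antipodal vertices `u ≠ w` have distance less than `diam / 2` from a class in the folded graph,
then the vertices of that class closest to `u` and to `w` are different and both tell `u` and `w`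
apart, so one vertex of the class may be discarded. A resolving set of the folded graph leaves at
most one class at distance `diam / 2` from all its members; adding that class if it exists, and
lifting all classes but for one vertex each, resolves `Γ`. Hence `μ(Γ) ≤ (t - 1) (μ(Γ̄) + 1)`.

For the folded graph we use Babai's argument. If any two of `n` vertices are told apart by at least
`D ≤ n / 2` vertices, then choosing vertices greedily gives `μ < 2 n log n / D`. In a primitive
distance-regular graph the number of vertices telling `x` and `y` apart depends only on the
distance `i` of `x` and `y`, and is subadditive along walks in the distance-`i` graph, which is
connected of diameter at most `diam`. Since every vertex is told apart from some other by at
least `n - M` vertices, one may take `D = (n - M) / diam`; if the distance-`i` graph has diameter at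
most 2, then `(n - M) / 2 ≥ √n / 2` vertices tell `x` and `y` apart, and otherwise comparison with
the spheres of radius `i` gives at least `√n / 2` as well.
-/

namespace MetricDimension

open Finset SimpleGraph

section Covering

variable {α β : Type*} [Fintype α] [Nonempty α] [DecidableEq α]

theorem exists_card_mul_div_le_card_filter_mem (P : Finset β) (T : β → Finset α) {D : ℝ}
    (hT : ∀ b ∈ P, D ≤ #(T b)) :
    ∃ a, #P * D / Fintype.card α ≤ #{b ∈ P | a ∈ T b} := by
  have double_count : ∑ a, #{b ∈ P | a ∈ T b} = ∑ b ∈ P, #(T b) := by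
    simpa only [bipartiteAbove, bipartiteBelow, filter_univ_mem] using
      sum_card_bipartiteAbove_eq_sum_card_bipartiteBelow (s := univ) (t := P) fun a b => a ∈ T b
  have total : ∑ _a : α, #P * D / Fintype.card α ≤ ∑ a, (#{b ∈ P | a ∈ T b} : ℝ) := by
    rw [sum_const, card_univ, nsmul_eq_mul, mul_div_cancel₀ _ (by simp), ← Nat.cast_sum,
      double_count, Nat.cast_sum, ← nsmul_eq_mul]
    exact card_nsmul_le_sum P _ D hT
  obtain ⟨a, -, ha⟩ := exists_le_of_sum_le univ_nonempty total
  exact ⟨a, ha⟩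

theorem exists_card_le_card_filter_disjoint_le (P : Finset β) (T : β → Finset α) {D : ℝ}
    (hD : D ≤ Fintype.card α) (hT : ∀ b ∈ P, D ≤ #(T b)) (m : ℕ) :
    ∃ S : Finset α, #S ≤ m ∧
      (#{b ∈ P | Disjoint S (T b)} : ℝ) ≤ #P * (1 - D / Fintype.card α) ^ m := by
  induction m with
  | zero => exact ⟨∅, by simp⟩
  | succ m ih =>
    obtain ⟨S, hS, hmissed⟩ := ih
    set missed := {b ∈ P | Disjoint S (T b)}
    obtain ⟨a, ha⟩ := exists_card_mul_div_le_card_filter_mem missed T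
      fun b hb => hT b (mem_of_mem_filter b hb)
    refine ⟨insert a S, (card_insert_le a S).trans (by lia), ?_⟩
    have still_missed : {b ∈ P | Disjoint (insert a S) (T b)} = {b ∈ missed | a ∉ T b} := by
      simp only [missed, disjoint_insert_left, filter_filter, and_comm]
    have split : (#{b ∈ missed | a ∈ T b} : ℝ) + #{b ∈ missed | a ∉ T b} = #missed :=
      mod_cast card_filter_add_card_filter_not (s := missed) fun b => a ∈ T b
    have ratio_nonneg : 0 ≤ 1 - D / Fintype.card α :=
      sub_nonneg.2 (div_le_one_of_le₀ hD (Nat.cast_nonneg _))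
    calc (#{b ∈ P | Disjoint (insert a S) (T b)} : ℝ)
        = #{b ∈ missed | a ∉ T b} := by rw [still_missed]
      _ ≤ #missed * (1 - D / Fintype.card α) := by rw [mul_sub, mul_one, ← mul_div_assoc]; linarith
      _ ≤ #P * (1 - D / Fintype.card α) ^ m * (1 - D / Fintype.card α) := by gcongr
      _ = #P * (1 - D / Fintype.card α) ^ (m + 1) := by ring

end Covering

section Distinguishers

variable {V : Type*} [Fintype V] {Γ : SimpleGraph V}

/-- The vertices whose distances to `x` and `y` differ, that is, those which tell `x` and `y`
apart. -/
noncomputable def distinguishers (Γ : SimpleGraph V) (x y : V) : Finset V :=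
  {z | Γ.dist x z ≠ Γ.dist y z}

theorem mem_distinguishers {x y z : V} :
    z ∈ distinguishers Γ x y ↔ Γ.dist x z ≠ Γ.dist y z := by
  simp [distinguishers]

theorem distinguishers_self (x : V) : distinguishers Γ x x = ∅ := by
  simp [distinguishers]

theorem distinguishers_comm (x y : V) : distinguishers Γ x y = distinguishers Γ y x := by
  simp only [distinguishers, ne_comm]

theorem card_distinguishers_triangle (x y z : V) :
    #(distinguishers Γ x z) ≤ #(distinguishers Γ x y) + #(distinguishers Γ y z) := by
  classical
  refine (card_le_card fun v hv => ?_).trans (card_union_le _ _)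
  simp only [mem_union, mem_distinguishers] at hv ⊢
  lia

theorem isResolving_iff_disjoint {S : Finset V} :
    Γ.IsResolving S ↔ ∀ x y, Disjoint S (distinguishers Γ x y) → x = y := by
  simp only [IsResolving, Finset.disjoint_left, mem_distinguishers, not_not]

theorem isResolving_of_card_disjoint_le_one [DecidableEq V] {S : Finset V}
    (hS : #{p ∈ univ.offDiag | Disjoint S (distinguishers Γ p.1 p.2)} ≤ 1) :
    Γ.IsResolving S := by
  refine isResolving_iff_disjoint.2 fun x y hxy => ?_
  by_contra hne
  have hpair : (x, y) = (y, x) :=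
    card_le_one.1 hS _ (by simpa using ⟨hne, hxy⟩) _
      (by simpa using ⟨Ne.symm hne, distinguishers_comm x y ▸ hxy⟩)
  exact hne (congrArg Prod.fst hpair)

end Distinguishers

theorem metricDimension_le_card {V : Type*} {Γ : SimpleGraph V} {S : Finset V}
    (hS : Γ.IsResolving S) : Γ.metricDimension ≤ #S :=
  Nat.sInf_le ⟨S, hS, rfl⟩

theorem exists_isResolving_card_eq_metricDimension {V : Type*} [Finite V] {Γ : SimpleGraph V}
    (hc : Γ.Connected) : ∃ S : Finset V, Γ.IsResolving S ∧ #S = Γ.metricDimension := by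
  have := Fintype.ofFinite V
  refine Nat.sInf_mem (s := {m | ∃ S : Finset V, Γ.IsResolving S ∧ #S = m})
    ⟨_, univ, fun u w huw => (hc.dist_eq_zero_iff.1 ?_).symm, rfl⟩
  rw [← huw u (mem_univ u), dist_self]

theorem one_sub_pow_le_two_mul_exp {x : ℝ} (hx : x ≤ 1 / 2) (m : ℕ) :
    (1 - x) ^ m ≤ 2 * Real.exp (-((m + 1) * x)) :=
  calc (1 - x) ^ m ≤ (1 - x) ^ m * (2 * (1 - x)) :=
        le_mul_of_one_le_right (pow_nonneg (by linarith) m) (by linarith)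
    _ = 2 * (1 - x) ^ (m + 1) := by ring
    _ ≤ 2 * Real.exp (-x) ^ (m + 1) := by
        gcongr
        · linarith
        · exact Real.one_sub_le_exp_neg x
    _ = 2 * Real.exp (-((m + 1) * x)) := by
        rw [← Real.exp_nat_mul]
        push_cast
        ring_nf

theorem metricDimension_lt_of_le_card_distinguishers {V : Type*} [Fintype V] [Nontrivial V]
    {Γ : SimpleGraph V} {D : ℝ} (hD₀ : 0 < D) (hD : D ≤ Fintype.card V / 2)
    (h : ∀ x y, x ≠ y → D ≤ #(distinguishers Γ x y)) :
    (Γ.metricDimension : ℝ) < 2 * Fintype.card V * Real.log (Fintype.card V) / D := by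
  classical
  have hn : (1 : ℝ) < Fintype.card V := mod_cast Fintype.one_lt_card (α := V)
  set n : ℝ := (Fintype.card V : ℝ)
  have hlog : 0 < Real.log n := Real.log_pos hn
  set B : ℝ := 2 * n * Real.log n / D with hB
  have hB₀ : 0 < B := by positivity
  obtain ⟨m, hm⟩ := Nat.exists_eq_succ_of_ne_zero (Nat.ceil_pos.2 hB₀).ne'
  have hmB : (m : ℝ) < B := Nat.lt_ceil.1 (by lia)
  have hBm : B ≤ m + 1 := mod_cast Nat.ceil_le.1 hm.le
  obtain ⟨S, hSm, hS⟩ := exists_card_le_card_filter_disjoint_le univ.offDiag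
    (fun p : V × V => distinguishers Γ p.1 p.2) (by linarith : D ≤ n)
    (fun p hp => h p.1 p.2 (mem_offDiag.1 hp).2.2) m
  have card_pairs : (#(univ : Finset V).offDiag : ℝ) = n * n - n := by
    rw [offDiag_card, card_univ, Nat.cast_sub (Nat.le_mul_self _), Nat.cast_mul]
  have pow_le : (1 - D / n) ^ m ≤ 2 / n ^ 2 :=
    calc (1 - D / n) ^ m ≤ 2 * Real.exp (-((m + 1) * (D / n))) :=
          one_sub_pow_le_two_mul_exp (by rw [div_le_iff₀ (by linarith)]; linarith) m
      _ ≤ 2 * Real.exp (-(B * (D / n))) := by gcongr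
      _ = 2 * Real.exp (-Real.log (n ^ 2)) := by
          rw [hB, Real.log_pow, div_mul_div_cancel₀ hD₀.ne', mul_right_comm,
            mul_div_cancel_right₀ _ (by linarith), Nat.cast_ofNat]
      _ = 2 / n ^ 2 := by rw [Real.exp_neg, Real.exp_log (by positivity), div_eq_mul_inv]
  have unresolved_lt_two :
      (#{p ∈ univ.offDiag | Disjoint S (distinguishers Γ p.1 p.2)} : ℝ) < 2 :=
    calc (#{p ∈ univ.offDiag | Disjoint S (distinguishers Γ p.1 p.2)} : ℝ)
        ≤ (n * n - n) * (1 - D / n) ^ m := card_pairs ▸ hS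
      _ ≤ (n * n - n) * (2 / n ^ 2) := by gcongr; nlinarith
      _ = 2 - 2 / n := by field_simp
      _ < 2 := sub_lt_self 2 (by positivity)
  have hres : Γ.IsResolving S :=
    isResolving_of_card_disjoint_le_one (Nat.lt_succ_iff.1 (mod_cast unresolved_lt_two))
  calc (Γ.metricDimension : ℝ) ≤ m := mod_cast (metricDimension_le_card hres).trans hSm
    _ < B := hmB

theorem exists_dist_eq_of_le_dist {V : Type*} {Γ : SimpleGraph V} (hc : Γ.Connected) {x y : V}
    {i : ℕ} (hi : i ≤ Γ.dist x y) : ∃ z, Γ.dist x z = i ∧ i + Γ.dist z y = Γ.dist x y := by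
  obtain ⟨p, hp⟩ := hc.exists_walk_length_eq_dist x y
  refine ⟨p.getVert i, ?_⟩
  have dist_start : Γ.dist x (p.getVert i) ≤ i := (dist_le (p.take i)).trans (by simp)
  have dist_end : Γ.dist (p.getVert i) y ≤ Γ.dist x y - i :=
    (dist_le (p.drop i)).trans (by simp [hp])
  have triangle : Γ.dist x y ≤ Γ.dist x (p.getVert i) + Γ.dist (p.getVert i) y := hc.dist_triangle
  lia

theorem dist_le_diam_of_connected {V : Type*} [Finite V] {Γ : SimpleGraph V} (hc : Γ.Connected)
    (x y : V) : Γ.dist x y ≤ Γ.diam :=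
  have := hc.nonempty
  dist_le_diam (connected_iff_ediam_ne_top.1 hc)

theorem sum_comp_eq_sum_range_mul_card {α : Type*} (s : Finset α) (g : α → ℕ) {f : ℕ → ℕ} {n : ℕ}
    (hf : ∀ l, n ≤ l → f l = 0) :
    ∑ z ∈ s, f (g z) = ∑ l ∈ range n, f l * #{z ∈ s | g z = l} := by
  have small : ∑ z ∈ s, f (g z) = ∑ z ∈ s with g z ∈ range n, f (g z) :=
    (sum_filter_of_ne fun z _ hz => mem_range.2 (not_le.1 fun hn => hz (hf _ hn))).symm
  rw [small, ← sum_fiberwise_eq_sum_filter]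
  refine sum_congr rfl fun l _ => ?_
  rw [sum_congr rfl fun z hz => by rw [(mem_filter.1 hz).2], sum_const, smul_eq_mul, mul_comm]

section IntersectionNumbers

variable {V : Type*} [Fintype V] {Γ : SimpleGraph V}

/-- The number of vertices at given distances from two vertices `x` and `y` depends only on the
distance of `x` and `y`. In this form distance-regularity passes to folded graphs. -/
def HasIntersectionNumbers (Γ : SimpleGraph V) : Prop :=
  ∀ i j : ℕ, ∀ x y x' y' : V, Γ.dist x y = Γ.dist x' y' →
    #{z | Γ.dist x z = i ∧ Γ.dist y z = j} = #{z | Γ.dist x' z = i ∧ Γ.dist y' z = j}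

theorem exists_card_neighbors_at_dist_eq [DecidableRel Γ.Adj] (h : Γ.IsDistanceRegular) :
    ∃ e : ℕ → ℕ → ℕ, (∀ x v j, #{w | Γ.Adj v w ∧ Γ.dist x w = j} = e (Γ.dist x v) j) ∧
      ∀ i j, j + 2 ≤ i → e i j = 0 := by
  obtain ⟨-, c, a, b, hcab⟩ := h
  refine ⟨fun i j => if j + 1 = i then c i else if j = i then a i else if j = i + 1 then b i else 0,
    fun x v j => ?_, fun i j hij => by grind⟩
  obtain ⟨hc_v, ha_v, hb_v⟩ := hcab x v
  rw [← Set.ncard_coe_finset, coe_filter_univ]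
  beta_reduce
  split_ifs with hj_sub hj_eq hj_add
  · rw [← hc_v, ← hj_sub]
    simp only [Nat.add_right_cancel_iff]
  · rw [hj_eq, ha_v]
  · rw [hj_add, hb_v]
  · refine (Set.ncard_eq_zero (Set.toFinite _)).2 (Set.eq_empty_of_forall_notMem ?_)
    rintro w ⟨hvw, hw⟩
    have := hvw.diff_dist_adj (u := x)
    lia

theorem sum_range_mul_card_at_dists_comm [DecidableRel Γ.Adj] {e : ℕ → ℕ → ℕ}
    (he : ∀ x v j, #{w | Γ.Adj v w ∧ Γ.dist x w = j} = e (Γ.dist x v) j)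
    (he₀ : ∀ i j, j + 2 ≤ i → e i j = 0) (x y : V) (i j : ℕ) :
    ∑ l ∈ range (j + 2), e l j * #{z | Γ.dist x z = i ∧ Γ.dist y z = l} =
      ∑ l ∈ range (i + 2), e l i * #{z | Γ.dist x z = l ∧ Γ.dist y z = j} := by
  have count : ∑ z with Γ.dist x z = i, e (Γ.dist y z) j =
      ∑ w with Γ.dist y w = j, e (Γ.dist x w) i := by
    simpa only [bipartiteAbove, bipartiteBelow, filter_filter, Γ.adj_comm _, and_comm, ← he] using
      sum_card_bipartiteAbove_eq_sum_card_bipartiteBelow (s := {z | Γ.dist x z = i})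
        (t := {w | Γ.dist y w = j}) Γ.Adj
  rw [sum_comp_eq_sum_range_mul_card _ _ fun l => he₀ l j,
    sum_comp_eq_sum_range_mul_card _ _ fun l => he₀ l i] at count
  simpa only [filter_filter, and_comm] using count

theorem hasIntersectionNumbers_of_isDistanceRegular (h : Γ.IsDistanceRegular) :
    HasIntersectionNumbers Γ := by
  classical
  obtain ⟨e, he, he₀⟩ := exists_card_neighbors_at_dist_eq h
  intro i j x y x' y' hxy
  induction j using Nat.strong_induction_on generalizing i with | _ j ih
  obtain _ | j := j
  · have count : ∀ u v : V, #{z | Γ.dist u z = i ∧ Γ.dist v z = 0} =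
        if Γ.dist u v = i then 1 else 0 := fun u v => by
      simp only [h.1.dist_eq_zero_iff, filter_and, filter_eq, mem_univ, if_true]
      by_cases hi : Γ.dist u v = i <;> simp [hi]
    rw [count, count, hxy]
  have recurrence := sum_range_mul_card_at_dists_comm he he₀ x y i j
  have recurrence' := sum_range_mul_card_at_dists_comm he he₀ x' y' i j
  simp only [sum_range_succ _ (j + 1), ih j j.lt_succ_self] at recurrence recurrence'
  have lower_terms : ∑ l ∈ range (j + 1), e l j * #{z | Γ.dist x z = i ∧ Γ.dist y z = l} =
      ∑ l ∈ range (j + 1), e l j * #{z | Γ.dist x' z = i ∧ Γ.dist y' z = l} :=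
    sum_congr rfl fun l hl => by rw [ih l (mem_range.1 hl) i]
  rw [lower_terms, ← recurrence'] at recurrence
  obtain h_zero | h_ne := (e (j + 1) j).eq_zero_or_pos
  · have empty : ∀ u v : V, #{z | Γ.dist u z = i ∧ Γ.dist v z = j + 1} = 0 := by
      refine fun u v => card_eq_zero.2 (filter_eq_empty_iff.2 fun z _ hz => ?_)
      obtain ⟨w, hw, hwz⟩ := exists_dist_eq_of_le_dist h.1 (x := v) (y := z) (i := j) (by lia)
      have hadj : Γ.Adj w z := dist_eq_one_iff_adj.1 (by lia)
      have := he v z j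
      rw [hz.2, h_zero, card_eq_zero, filter_eq_empty_iff] at this
      exact this (mem_univ w) ⟨hadj.symm, hw⟩
    rw [empty, empty]
  · exact Nat.eq_of_mul_eq_mul_left h_ne (Nat.add_left_cancel recurrence)

theorem HasIntersectionNumbers.card_filter_congr (h : HasIntersectionNumbers Γ) {x y x' y' : V}
    (hxy : Γ.dist x y = Γ.dist x' y') (P : ℕ → ℕ → Prop) [∀ i j, Decidable (P i j)] :
    #{z | P (Γ.dist x z) (Γ.dist y z)} = #{z | P (Γ.dist x' z) (Γ.dist y' z)} := by
  have same_dists : univ.val.map (fun z => (Γ.dist x z, Γ.dist y z)) =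
      univ.val.map fun z => (Γ.dist x' z, Γ.dist y' z) := by
    ext ⟨i, j⟩
    simp only [Multiset.count_map, Prod.mk.injEq, eq_comm (a := i), eq_comm (a := j)]
    exact h i j x y x' y' hxy
  have := congrArg (Multiset.countP fun k : ℕ × ℕ => P k.1 k.2) same_dists
  rwa [Multiset.countP_map, Multiset.countP_map] at this

theorem HasIntersectionNumbers.exists_dist_eq (h : HasIntersectionNumbers Γ) {x y x' y' : V}
    (hxy : Γ.dist x y = Γ.dist x' y') (z : V) :
    ∃ z', Γ.dist x' z' = Γ.dist x z ∧ Γ.dist y' z' = Γ.dist y z := by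
  have hpos : 0 < #{w | Γ.dist x w = Γ.dist x z ∧ Γ.dist y w = Γ.dist y z} :=
    card_pos.2 ⟨z, by simp⟩
  rw [h _ _ x y x' y' hxy] at hpos
  obtain ⟨z', hz'⟩ := card_pos.1 hpos
  exact ⟨z', (mem_filter.1 hz').2⟩

end IntersectionNumbers

/-- Every geodesic extends beyond its end to one whose length is the diameter. This is all that the
description of distances in folded graphs needs of distance-regularity. -/
def GeodesicsExtend {V : Type*} (Γ : SimpleGraph V) : Prop :=
  ∀ x y : V, ∃ z, Γ.dist x z = Γ.diam ∧ Γ.dist x y + Γ.dist y z = Γ.diam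

theorem HasIntersectionNumbers.geodesicsExtend {V : Type*} [Fintype V] {Γ : SimpleGraph V}
    (h : HasIntersectionNumbers Γ) (hc : Γ.Connected) : GeodesicsExtend Γ := fun x y => by
  have := hc.nonempty
  obtain ⟨p, q, hpq⟩ := Γ.exists_dist_eq_diam
  obtain ⟨v, hpv, hvq⟩ :=
    exists_dist_eq_of_le_dist hc (hpq ▸ dist_le_diam_of_connected hc x y : _ ≤ Γ.dist p q)
  obtain ⟨z, hxz, hyz⟩ := h.exists_dist_eq hpv q
  exact ⟨z, by lia, by lia⟩

section Antipodal

variable {V : Type*} {Γ : SimpleGraph V}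

theorem dist_eq_diam_of_antipodalRel (hc : Γ.Connected) {u v : V} (huv : Γ.AntipodalRel u v)
    (hne : u ≠ v) : Γ.dist u v = Γ.diam :=
  huv.resolve_left (hc.dist_eq_zero_iff.not.2 hne)

theorem GeodesicsExtend.dist_add_dist_eq_diam_or_dist_le (hg : GeodesicsExtend Γ)
    (hc : Γ.Connected) (he : Equivalence Γ.AntipodalRel) (u : V) {v w : V}
    (hvw : Γ.AntipodalRel v w) :
    Γ.dist u v + Γ.dist u w = Γ.diam ∨ Γ.dist u v ≤ Γ.dist u w := by
  obtain ⟨z, hvz, hz⟩ := hg v u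
  rw [dist_comm (u := v)] at hz
  obtain rfl | hne := eq_or_ne z w
  · exact .inl hz
  have hzw : Γ.dist z w = Γ.diam :=
    dist_eq_diam_of_antipodalRel hc (he.trans (he.symm (.inr hvz)) hvw) hne
  have triangle : Γ.dist z w ≤ Γ.dist z u + Γ.dist u w := hc.dist_triangle
  rw [dist_comm (u := z) (v := u)] at triangle
  lia

theorem GeodesicsExtend.dist_add_dist_eq_diam_or_dist_eq (hg : GeodesicsExtend Γ)
    (hc : Γ.Connected) (he : Equivalence Γ.AntipodalRel) (u : V) {v w : V}
    (hvw : Γ.AntipodalRel v w) :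
    Γ.dist u v + Γ.dist u w = Γ.diam ∨ Γ.dist u v = Γ.dist u w := by
  have := hg.dist_add_dist_eq_diam_or_dist_le hc he u hvw
  have := hg.dist_add_dist_eq_diam_or_dist_le hc he u (he.symm hvw)
  lia

theorem GeodesicsExtend.dist_add_dist_eq_diam (hg : GeodesicsExtend Γ) (hc : Γ.Connected)
    (he : Equivalence Γ.AntipodalRel) {u v w : V} (hvw : Γ.AntipodalRel v w) (hne : v ≠ w)
    (huv : 2 * Γ.dist u v ≤ Γ.diam) : Γ.dist u v + Γ.dist u w = Γ.diam := by
  have hdiam : Γ.dist v w = Γ.diam := dist_eq_diam_of_antipodalRel hc hvw hne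
  have triangle : Γ.dist v w ≤ Γ.dist v u + Γ.dist u w := hc.dist_triangle
  rw [dist_comm (u := v) (v := u)] at triangle
  have := hg.dist_add_dist_eq_diam_or_dist_eq hc he u hvw
  lia

theorem GeodesicsExtend.exists_antipodalRel_dist_eq_min (hg : GeodesicsExtend Γ)
    (he : Equivalence Γ.AntipodalRel) (u v : V) :
    ∃ w, Γ.AntipodalRel v w ∧ Γ.dist u w = min (Γ.dist u v) (Γ.diam - Γ.dist u v) := by
  obtain hle | hlt := le_total (2 * Γ.dist u v) Γ.diam
  · exact ⟨v, he.refl v, by lia⟩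
  · obtain ⟨z, hvz, hz⟩ := hg v u
    rw [dist_comm (u := v)] at hz
    exact ⟨z, .inr hvz, by lia⟩

variable {t : ℕ} (hanti : Γ.IsAntipodal t)

/-- The antipodal class of a vertex, as a vertex of the folded graph. -/
abbrev antipodalClass (v : V) : Quotient hanti.setoid :=
  Quotient.mk _ v

theorem antipodalClass_eq_iff {u v : V} :
    antipodalClass hanti u = antipodalClass hanti v ↔ Γ.AntipodalRel u v :=
  Quotient.eq

/-- The projection of an antipodal graph onto its folded graph. -/
def foldHom (hd : 2 ≤ Γ.diam) : Γ →g hanti.foldedGraph where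
  toFun := antipodalClass hanti
  map_rel' {u v} huv := by
    refine ⟨fun heq => ?_, u, v, rfl, rfl, huv⟩
    have := dist_eq_one_iff_adj.2 huv
    obtain h | h := (antipodalClass_eq_iff hanti).1 heq <;> lia

theorem foldedGraph_connected (hc : Γ.Connected) (hd : 2 ≤ Γ.diam) :
    hanti.foldedGraph.Connected :=
  hc.map (foldHom hanti hd) Quotient.mk_surjective

theorem foldedGraph_dist_le (hc : Γ.Connected) (hd : 2 ≤ Γ.diam) (u v : V) :
    hanti.foldedGraph.dist (antipodalClass hanti u) (antipodalClass hanti v) ≤ Γ.dist u v := by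
  obtain ⟨p, hp⟩ := hc.exists_walk_length_eq_dist u v
  exact (dist_le (p.map (foldHom hanti hd))).trans (by simp [hp])

theorem exists_adj_of_foldedGraph_adj (hg : GeodesicsExtend Γ) (hc : Γ.Connected) {u : V}
    {D : Quotient hanti.setoid} (hD : hanti.foldedGraph.Adj (antipodalClass hanti u) D) :
    ∃ v, antipodalClass hanti v = D ∧ Γ.Adj u v := by
  obtain ⟨hne, u₀, v₀, hu₀, rfl, hadj⟩ := hD
  obtain ⟨v, hv, huv⟩ := hg.exists_antipodalRel_dist_eq_min hanti.equivalence u v₀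
  have hclass : antipodalClass hanti v = antipodalClass hanti v₀ :=
    ((antipodalClass_eq_iff hanti).2 hv).symm
  refine ⟨v, hclass, dist_eq_one_iff_adj.1 ?_⟩
  have h₀ := hg.dist_add_dist_eq_diam_or_dist_eq hc hanti.equivalence v₀
    ((antipodalClass_eq_iff hanti).1 hu₀)
  rw [dist_comm (u := v₀) (v := u₀), dist_eq_one_iff_adj.2 hadj, dist_comm] at h₀
  have hpos : Γ.dist u v ≠ 0 := fun h => hne (hc.dist_eq_zero_iff.1 h ▸ hclass)
  lia

theorem exists_dist_le_length_of_foldedGraph_walk (hg : GeodesicsExtend Γ) (hc : Γ.Connected)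
    {C D : Quotient hanti.setoid} (p : hanti.foldedGraph.Walk C D) {u : V}
    (hu : antipodalClass hanti u = C) :
    ∃ v, antipodalClass hanti v = D ∧ Γ.dist u v ≤ p.length := by
  induction p generalizing u with
  | nil => exact ⟨u, hu, by simp⟩
  | cons hadj p ih =>
    obtain ⟨w, hw, huw⟩ := exists_adj_of_foldedGraph_adj hanti hg hc (hu ▸ hadj)
    obtain ⟨v, hv, hwv⟩ := ih hw
    refine ⟨v, hv, ?_⟩
    have triangle : Γ.dist u v ≤ Γ.dist u w + Γ.dist w v := hc.dist_triangle
    rw [dist_eq_one_iff_adj.2 huw] at triangle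
    rw [Walk.length_cons]
    lia

theorem foldedGraph_dist (hg : GeodesicsExtend Γ) (hc : Γ.Connected) (hd : 2 ≤ Γ.diam)
    (u v : V) :
    hanti.foldedGraph.dist (antipodalClass hanti u) (antipodalClass hanti v) =
      min (Γ.dist u v) (Γ.diam - Γ.dist u v) := by
  apply le_antisymm
  · obtain ⟨w, hvw, hw⟩ := hg.exists_antipodalRel_dist_eq_min hanti.equivalence u v
    rw [← hw, (antipodalClass_eq_iff hanti).2 hvw]
    exact foldedGraph_dist_le hanti hc hd u w
  · obtain ⟨p, hp⟩ := (foldedGraph_connected hanti hc hd).exists_walk_length_eq_dist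
      (antipodalClass hanti u) (antipodalClass hanti v)
    obtain ⟨w, hw, huw⟩ := exists_dist_le_length_of_foldedGraph_walk hanti hg hc p rfl
    have := hg.dist_add_dist_eq_diam_or_dist_eq hc hanti.equivalence u
      ((antipodalClass_eq_iff hanti).1 hw)
    lia

theorem two_mul_foldedGraph_dist_le (hg : GeodesicsExtend Γ) (hc : Γ.Connected)
    (hd : 2 ≤ Γ.diam) (C D : Quotient hanti.setoid) :
    2 * hanti.foldedGraph.dist C D ≤ Γ.diam := by
  obtain ⟨u, rfl⟩ := Quotient.mk_surjective C
  obtain ⟨v, rfl⟩ := Quotient.mk_surjective D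
  rw [foldedGraph_dist hanti hg hc hd]
  lia

theorem exists_antipodalClass_eq_dist_eq_foldedGraph_dist (hg : GeodesicsExtend Γ)
    (hc : Γ.Connected) (hd : 2 ≤ Γ.diam) (u : V) (C : Quotient hanti.setoid) :
    ∃ v, antipodalClass hanti v = C ∧
      Γ.dist u v = hanti.foldedGraph.dist (antipodalClass hanti u) C := by
  obtain ⟨v, rfl⟩ := Quotient.mk_surjective C
  obtain ⟨w, hvw, hw⟩ := hg.exists_antipodalRel_dist_eq_min hanti.equivalence u v
  exact ⟨w, ((antipodalClass_eq_iff hanti).2 hvw).symm,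
    by rw [hw, foldedGraph_dist hanti hg hc hd]⟩

theorem exists_distinguishing_pair_of_foldedGraph_dist_lt (hg : GeodesicsExtend Γ)
    (hc : Γ.Connected) (hd : 2 ≤ Γ.diam) {u w : V} (huw : Γ.AntipodalRel u w)
    (hne : u ≠ w) {C : Quotient hanti.setoid}
    (hC : 2 * hanti.foldedGraph.dist (antipodalClass hanti u) C < Γ.diam) :
    ∃ v v', v ≠ v' ∧ (antipodalClass hanti v = C ∧ Γ.dist u v ≠ Γ.dist w v) ∧
      antipodalClass hanti v' = C ∧ Γ.dist u v' ≠ Γ.dist w v' := by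
  obtain ⟨v, hvC, hv⟩ :=
    exists_antipodalClass_eq_dist_eq_foldedGraph_dist hanti hg hc hd u C
  obtain ⟨v', hvC', hv'⟩ :=
    exists_antipodalClass_eq_dist_eq_foldedGraph_dist hanti hg hc hd w C
  rw [← (antipodalClass_eq_iff hanti).2 huw] at hv'
  have complement : Γ.dist v u + Γ.dist v w = Γ.diam :=
    hg.dist_add_dist_eq_diam hc hanti.equivalence huw hne (by rw [dist_comm]; lia)
  have complement' : Γ.dist v' w + Γ.dist v' u = Γ.diam :=
    hg.dist_add_dist_eq_diam hc hanti.equivalence (hanti.equivalence.symm huw) hne.symm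
      (by rw [dist_comm]; lia)
  rw [dist_comm, dist_comm (v := w)] at complement
  rw [dist_comm, dist_comm (v := u)] at complement'
  refine ⟨v, v', ?_, ⟨hvC, by lia⟩, hvC', by lia⟩
  rintro rfl
  lia

theorem two_le_of_isAntipodal [Finite V] (hanti : Γ.IsAntipodal t) (hc : Γ.Connected)
    (hd : Γ.diam ≠ 0) : 2 ≤ t := by
  have := hc.nonempty
  obtain ⟨p, q, hpq⟩ := Γ.exists_dist_eq_diam
  rw [← hanti.ncard_class p]
  refine (Set.one_lt_ncard (Set.toFinite _)).2 ⟨p, .inl dist_self, q, .inr hpq, ?_⟩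
  rintro rfl
  exact hd (by rw [← hpq, dist_self])

variable [Fintype V]

theorem card_antipodalClass_eq [DecidableEq (Quotient hanti.setoid)]
    (C : Quotient hanti.setoid) : #{v | antipodalClass hanti v = C} = t := by
  obtain ⟨u, rfl⟩ := Quotient.mk_surjective C
  refine Eq.trans ?_ (hanti.ncard_class u)
  rw [← Set.ncard_coe_finset, coe_filter_univ]
  exact congrArg Set.ncard (Set.ext fun v => eq_comm.trans (antipodalClass_eq_iff hanti))

theorem card_antipodalClass_mem [DecidableEq (Quotient hanti.setoid)]
    (T : Finset (Quotient hanti.setoid)) : #{v | antipodalClass hanti v ∈ T} = #T * t := by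
  rw [← sum_card_fiberwise_eq_card_filter]
  exact sum_const_nat fun C _ => card_antipodalClass_eq hanti C

theorem card_eq_card_quotient_mul [Fintype (Quotient hanti.setoid)] :
    Fintype.card V = Fintype.card (Quotient hanti.setoid) * t := by
  classical
  simpa using card_antipodalClass_mem hanti univ

theorem HasIntersectionNumbers.foldedGraph [Fintype (Quotient hanti.setoid)]
    (h : HasIntersectionNumbers Γ) (hc : Γ.Connected) (hd : 2 ≤ Γ.diam) :
    HasIntersectionNumbers hanti.foldedGraph := by
  classical
  have hg := h.geodesicsExtend hc
  have count_mul : ∀ i j x y,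
      #{Z | hanti.foldedGraph.dist (antipodalClass hanti x) Z = i ∧
        hanti.foldedGraph.dist (antipodalClass hanti y) Z = j} * t =
      #{z | min (Γ.dist x z) (Γ.diam - Γ.dist x z) = i ∧
        min (Γ.dist y z) (Γ.diam - Γ.dist y z) = j} := fun i j x y => by
    rw [← card_antipodalClass_mem hanti]
    simp only [mem_filter, mem_univ, true_and, foldedGraph_dist hanti hg hc hd]
  intro i j X Y X' Y' hXY
  obtain ⟨x, rfl⟩ := Quotient.mk_surjective X
  obtain ⟨x', rfl⟩ := Quotient.mk_surjective X'
  obtain ⟨y, rfl, hxy⟩ := exists_antipodalClass_eq_dist_eq_foldedGraph_dist hanti hg hc hd x Y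
  obtain ⟨y', rfl, hxy'⟩ := exists_antipodalClass_eq_dist_eq_foldedGraph_dist hanti hg hc hd x' Y'
  refine Nat.eq_of_mul_eq_mul_right
    (zero_lt_two.trans_le (two_le_of_isAntipodal hanti hc (by lia))) ?_
  rw [count_mul, count_mul]
  exact h.card_filter_congr (hxy.trans (hXY.trans hxy'.symm))
    fun a b => min a (Γ.diam - a) = i ∧ min b (Γ.diam - b) = j

end Antipodal

theorem exists_superset_forall_exists_dist_lt {V : Type*} {Γ : SimpleGraph V} {S : Finset V}
    (hS : Γ.IsResolving S) {k : ℕ} (hk : 0 < k) (hdist : ∀ u v, Γ.dist u v ≤ k) :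
    ∃ T : Finset V, S ⊆ T ∧ #T ≤ #S + 1 ∧ ∀ u, ∃ v ∈ T, Γ.dist u v < k := by
  classical
  by_cases hfar : ∃ u₀, ∀ v ∈ S, Γ.dist u₀ v = k
  · obtain ⟨u₀, hu₀⟩ := hfar
    refine ⟨insert u₀ S, subset_insert u₀ S, card_insert_le u₀ S, fun u => ?_⟩
    by_contra! hu
    have heq : u = u₀ := hS u u₀ fun v hv => by
      rw [hu₀ v hv, (hdist u v).antisymm (hu v (mem_insert_of_mem hv))]
    have := hu u₀ (mem_insert_self u₀ S)
    rw [heq, dist_self] at this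
    lia
  · push Not at hfar
    refine ⟨S, Subset.rfl, Nat.le_succ _, fun u => ?_⟩
    obtain ⟨v, hv, huv⟩ := hfar u
    exact ⟨v, hv, (hdist u v).lt_of_ne huv⟩

section PuncturedLift

variable {V : Type*} [Fintype V] {Γ : SimpleGraph V} {t : ℕ} (hanti : Γ.IsAntipodal t)

open scoped Classical in
/-- The vertices of the antipodal classes in `T`, except for one representative of each class: this
lifts a resolving set of the folded graph to one of the graph itself. -/
noncomputable def puncturedLift (T : Finset (Quotient hanti.setoid)) : Finset V :=
  {v | antipodalClass hanti v ∈ T ∧ v ≠ (antipodalClass hanti v).out}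

theorem mem_puncturedLift {T : Finset (Quotient hanti.setoid)} {v : V} :
    v ∈ puncturedLift hanti T ↔
      antipodalClass hanti v ∈ T ∧ v ≠ (antipodalClass hanti v).out := by
  simp [puncturedLift]

theorem card_puncturedLift (T : Finset (Quotient hanti.setoid)) :
    #(puncturedLift hanti T) = #T * (t - 1) := by
  classical
  rw [card_eq_sum_card_fiberwise (f := antipodalClass hanti) (t := T)
    fun v hv => ((mem_puncturedLift hanti).1 hv).1]
  refine sum_const_nat fun C hC => ?_
  have fiber : {v ∈ puncturedLift hanti T | antipodalClass hanti v = C} =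
      ({v | antipodalClass hanti v = C} : Finset V).erase C.out := by
    ext v
    simp only [mem_filter, mem_puncturedLift, mem_erase, mem_univ, true_and]
    grind
  rw [fiber, card_erase_of_mem (by simp), card_antipodalClass_eq]

theorem isResolving_puncturedLift (hg : GeodesicsExtend Γ) (hc : Γ.Connected) (hd : 2 ≤ Γ.diam)
    {T : Finset (Quotient hanti.setoid)} (hT : hanti.foldedGraph.IsResolving T)
    (hnear : ∀ X, ∃ C ∈ T, 2 * hanti.foldedGraph.dist X C < Γ.diam) :
    Γ.IsResolving (puncturedLift hanti T) := by
  classical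
  intro u w huw
  have hclass : antipodalClass hanti u = antipodalClass hanti w := by
    refine hT _ _ fun C hC => ?_
    obtain ⟨v, hv, hvout⟩ : ∃ v ∈ ({v | antipodalClass hanti v = C} : Finset V), v ≠ C.out :=
      exists_mem_ne (by
        rw [card_antipodalClass_eq]
        exact two_le_of_isAntipodal hanti hc (by lia)) _
    obtain rfl : antipodalClass hanti v = C := (mem_filter.1 hv).2
    rw [foldedGraph_dist hanti hg hc hd, foldedGraph_dist hanti hg hc hd,
      huw v ((mem_puncturedLift hanti).2 ⟨hC, hvout⟩)]
  by_contra hne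
  obtain ⟨C, hCT, hC⟩ := hnear (antipodalClass hanti u)
  obtain ⟨v, v', hvv', ⟨hvC, hv⟩, hvC', hv'⟩ :=
    exists_distinguishing_pair_of_foldedGraph_dist_lt hanti hg hc hd
      ((antipodalClass_eq_iff hanti).1 hclass) hne hC
  have hmem : v ∈ puncturedLift hanti T ∨ v' ∈ puncturedLift hanti T := by
    simp only [mem_puncturedLift, hvC, hvC', hCT, true_and]
    grind
  obtain hmem | hmem := hmem
  · exact hv (huw v hmem)
  · exact hv' (huw v' hmem)

end PuncturedLift

theorem metricDimension_le_metricDimension_foldedGraph_add_one_mul {V : Type*} [Finite V]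
    {Γ : SimpleGraph V} {t : ℕ} (hanti : Γ.IsAntipodal t) (hg : GeodesicsExtend Γ)
    (hc : Γ.Connected) (hd : 2 ≤ Γ.diam) :
    Γ.metricDimension ≤ (hanti.foldedGraph.metricDimension + 1) * (t - 1) := by
  have := Fintype.ofFinite V
  have : Finite (Quotient hanti.setoid) := Quotient.finite _
  obtain ⟨S, hS, hcard⟩ :=
    exists_isResolving_card_eq_metricDimension (foldedGraph_connected hanti hc hd)
  obtain ⟨T, hST, hTcard, hnear⟩ := exists_superset_forall_exists_dist_lt hS
    (k := Γ.diam / 2) (by lia) fun C D => by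
      have := two_mul_foldedGraph_dist_le hanti hg hc hd C D
      lia
  have hT : hanti.foldedGraph.IsResolving T := fun X Y h => hS X Y fun C hC => h C (hST hC)
  have hres : Γ.IsResolving (puncturedLift hanti T) :=
    isResolving_puncturedLift hanti hg hc hd hT fun X => by
      obtain ⟨C, hC, hXC⟩ := hnear X
      exact ⟨C, hC, by lia⟩
  calc Γ.metricDimension ≤ #T * (t - 1) := card_puncturedLift hanti T ▸ metricDimension_le_card hres
    _ ≤ (hanti.foldedGraph.metricDimension + 1) * (t - 1) := by rw [← hcard]; gcongr

theorem metricDimension_lt_of_metricDimension_foldedGraph_lt {V : Type*} [Finite V]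
    {Γ : SimpleGraph V} {t : ℕ} (hanti : Γ.IsAntipodal t) (hg : GeodesicsExtend Γ)
    (hc : Γ.Connected) (hd : 2 ≤ Γ.diam) {B : ℝ} (hB : hanti.foldedGraph.metricDimension < B) :
    Γ.metricDimension < ((t : ℝ) - 1) * (B + 1) := by
  have ht : (2 : ℝ) ≤ t := mod_cast two_le_of_isAntipodal hanti hc (by lia)
  calc (Γ.metricDimension : ℝ)
      ≤ (hanti.foldedGraph.metricDimension + 1) * ((t - 1 : ℕ) : ℝ) :=
        mod_cast metricDimension_le_metricDimension_foldedGraph_add_one_mul hanti hg hc hd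
    _ = (t - 1) * (hanti.foldedGraph.metricDimension + 1) := by
        rw [Nat.cast_pred (two_pos.trans_le (mod_cast ht)), mul_comm]
    _ < (t - 1) * (B + 1) := by gcongr; linarith

section DistanceGraph

variable {V : Type*} [Fintype V] {Γ : SimpleGraph V}

theorem HasIntersectionNumbers.card_distinguishers_congr (h : HasIntersectionNumbers Γ)
    {x y x' y' : V} (hxy : Γ.dist x y = Γ.dist x' y') :
    #(distinguishers Γ x y) = #(distinguishers Γ x' y') :=
  h.card_filter_congr hxy (· ≠ ·)

theorem HasIntersectionNumbers.card_filter_dist_congr (h : HasIntersectionNumbers Γ)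
    (P : ℕ → Prop) [DecidablePred P] (x x' : V) :
    #{z | P (Γ.dist x z)} = #{z | P (Γ.dist x' z)} :=
  h.card_filter_congr (y := x) (y' := x') (by simp only [dist_self]) fun i _ => P i

theorem HasIntersectionNumbers.card_distinguishers_le_length_mul (h : HasIntersectionNumbers Γ)
    {a b x y : V} (p : (Γ.distanceGraph (Γ.dist a b)).Walk x y) :
    #(distinguishers Γ x y) ≤ p.length * #(distinguishers Γ a b) := by
  induction p with
  | nil => simp [distinguishers_self]
  | @cons x z y hadj p ih =>
    calc #(distinguishers Γ x y)
        ≤ #(distinguishers Γ x z) + #(distinguishers Γ z y) := card_distinguishers_triangle x z y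
      _ ≤ #(distinguishers Γ a b) + p.length * #(distinguishers Γ a b) :=
          add_le_add (h.card_distinguishers_congr hadj.2).le ih
      _ = (Walk.cons hadj p).length * #(distinguishers Γ a b) := by rw [Walk.length_cons]; ring

theorem HasIntersectionNumbers.card_distinguishers_le_dist_mul (h : HasIntersectionNumbers Γ)
    {a b : V} (hab : (Γ.distanceGraph (Γ.dist a b)).Connected) (x y : V) :
    #(distinguishers Γ x y) ≤
      (Γ.distanceGraph (Γ.dist a b)).dist x y * #(distinguishers Γ a b) := by
  obtain ⟨p, hp⟩ := hab.exists_walk_length_eq_dist x y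
  exact hp ▸ h.card_distinguishers_le_length_mul p

theorem HasIntersectionNumbers.exists_distanceGraph_walk_length_eq (h : HasIntersectionNumbers Γ)
    (hc : Γ.Connected) {i : ℕ} {x y x' y' : V} (p : (Γ.distanceGraph i).Walk x y)
    (hxy : Γ.dist x y = Γ.dist x' y') :
    ∃ q : (Γ.distanceGraph i).Walk x' y', q.length = p.length := by
  induction p generalizing x' with
  | nil =>
    rw [dist_self] at hxy
    obtain rfl := hc.dist_eq_zero_iff.1 hxy.symm
    exact ⟨.nil, rfl⟩
  | @cons x z y hadj p ih =>
    obtain ⟨z', hxz, hyz⟩ := h.exists_dist_eq hxy z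
    obtain ⟨q, hq⟩ := ih (x' := z') (by rw [dist_comm, ← hyz, dist_comm])
    have hne : x' ≠ z' := fun heq =>
      hadj.1 (hc.dist_eq_zero_iff.1 (by rw [← hxz, heq, dist_self]))
    exact ⟨.cons ⟨hne, hxz.trans hadj.2⟩ q, congrArg (· + 1) hq⟩

theorem HasIntersectionNumbers.dist_distanceGraph_congr (h : HasIntersectionNumbers Γ)
    (hc : Γ.Connected) {i : ℕ} (hi : (Γ.distanceGraph i).Connected) {x y x' y' : V}
    (hxy : Γ.dist x y = Γ.dist x' y') :
    (Γ.distanceGraph i).dist x y = (Γ.distanceGraph i).dist x' y' := by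
  have dist_le_dist : ∀ {u v u' v' : V}, Γ.dist u v = Γ.dist u' v' →
      (Γ.distanceGraph i).dist u' v' ≤ (Γ.distanceGraph i).dist u v := fun {u v _ _} huv => by
    obtain ⟨p, hp⟩ := hi.exists_walk_length_eq_dist u v
    obtain ⟨q, hq⟩ := h.exists_distanceGraph_walk_length_eq hc p huv
    exact hp ▸ hq ▸ dist_le q
  exact (dist_le_dist hxy.symm).antisymm (dist_le_dist hxy)

theorem HasIntersectionNumbers.dist_distanceGraph_le_diam (h : HasIntersectionNumbers Γ)
    (hc : Γ.Connected) {i : ℕ} (hi : (Γ.distanceGraph i).Connected) (x y : V) :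
    (Γ.distanceGraph i).dist x y ≤ Γ.diam := by
  -- Vertices along a geodesic of the distance-`i` graph lie at distinct distances from `x` in `Γ`.
  have hgeodesic : ∀ k ≤ (Γ.distanceGraph i).dist x y, ∃ z, (Γ.distanceGraph i).dist x z = k :=
    fun k hk => (exists_dist_eq_of_le_dist hi hk).imp fun _ hz => hz.1
  have := hc.nonempty
  choose! z hz using hgeodesic
  have hcard := card_le_card_of_injOn (s := range ((Γ.distanceGraph i).dist x y + 1))
    (t := range (Γ.diam + 1)) (fun k => Γ.dist x (z k))
    (fun k _ => mem_range_succ_iff.2 (dist_le_diam_of_connected hc x (z k)))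
    fun k hk l hl hkl => by
      rw [← hz k (mem_range_succ_iff.1 hk), ← hz l (mem_range_succ_iff.1 hl)]
      exact h.dist_distanceGraph_congr hc hi hkl
  simpa using hcard

theorem HasIntersectionNumbers.card_le_card_sphere_mul (h : HasIntersectionNumbers Γ)
    (hc : Γ.Connected) {a b : V} (hne : a ≠ b)
    (hab : (Γ.distanceGraph (Γ.dist a b)).Connected) :
    Fintype.card V ≤ #{w | Γ.dist a w = Γ.dist a b} * #(distinguishers Γ a b) := by
  classical
  have exists_distinguished : ∀ z, ∃ y, Γ.dist a y = Γ.dist a b ∧ z ∈ distinguishers Γ a y := by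
    intro z
    simp only [mem_distinguishers]
    obtain rfl | haz := eq_or_ne a z
    · exact ⟨b, rfl, by rw [dist_self]; exact (hc.pos_dist_of_ne hne.symm).ne⟩
    · obtain ⟨y, hay, hyz⟩ := exists_dist_eq_of_le_dist hab (hab.pos_dist_of_ne haz)
      refine ⟨y, (dist_eq_one_iff_adj.1 hay).2, fun hdist => ?_⟩
      have := h.dist_distanceGraph_congr hc hab hdist
      lia
  simpa using card_mul_le_card_mul (s := univ) (t := {w | Γ.dist a w = Γ.dist a b})
    (m := 1) (n := #(distinguishers Γ a b)) (fun z y => z ∈ distinguishers Γ a y)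
    (fun z _ => card_pos.2 <| by
      obtain ⟨y, hay, hzy⟩ := exists_distinguished z
      exact ⟨y, by simpa [bipartiteAbove] using ⟨hay, hzy⟩⟩)
    fun y hy => by
      rw [bipartiteBelow, filter_univ_mem, h.card_distinguishers_congr (mem_filter.1 hy).2]

theorem card_sphere_add_card_sphere_le_card_distinguishers {i : ℕ} (hi : i ≠ 0) {x y : V}
    (hxy : 2 < (Γ.distanceGraph i).dist x y) :
    #{z | Γ.dist x z = i} + #{z | Γ.dist y z = i} ≤ #(distinguishers Γ x y) := by
  classical
  have hadj : ∀ {u v : V}, Γ.dist u v = i → (Γ.distanceGraph i).Adj u v := fun huv =>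
    ⟨fun heq => hi (by rw [← huv, heq, dist_self]), huv⟩
  have no_common : ∀ z, Γ.dist x z = i → Γ.dist y z ≠ i := fun z hxz hyz =>
    hxy.not_ge (dist_le (.cons (hadj hxz) (.cons (hadj hyz).symm .nil)))
  rw [← card_union_of_disjoint (Finset.disjoint_left.2 fun z hxz hyz =>
    no_common z (mem_filter.1 hxz).2 (mem_filter.1 hyz).2)]
  refine card_le_card fun z hz => ?_
  simp only [mem_union, mem_filter, mem_univ, true_and, mem_distinguishers] at hz ⊢
  have := no_common z
  lia

theorem HasIntersectionNumbers.exists_dist_ne_dist_ne (h : HasIntersectionNumbers Γ) {i m : ℕ}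
    (hi : (Γ.distanceGraph i).Connected) (him : i ≠ m) (hm : m ≠ 0) (x w : V) :
    ∃ v, Γ.dist x v ≠ m ∧ Γ.dist v w ≠ m := by
  by_contra! hnone
  have hxw : Γ.dist x w = m := hnone x (by rw [dist_self]; exact hm.symm)
  -- Otherwise being at a distance other than `m` is transitive, so it holds throughout the
  -- connected distance-`i` graph.
  have ne_trans : ∀ {u v z : V}, Γ.dist u v ≠ m → Γ.dist v z ≠ m → Γ.dist u z ≠ m := by
    intro u v z huv hvz huz
    obtain ⟨v', hxv', hwv'⟩ := h.exists_dist_eq (huz.trans hxw.symm) v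
    refine hvz ?_
    rw [dist_comm, ← hwv', dist_comm]
    exact hnone v' (hxv' ▸ huv)
  obtain ⟨p⟩ := hi.preconnected x w
  suffices ∀ {u v : V}, (Γ.distanceGraph i).Walk u v → Γ.dist u v ≠ m from this p hxw
  intro u v p
  induction p with
  | nil => rw [dist_self]; exact hm.symm
  | cons hadj _ ih => exact ne_trans (hadj.2.trans_ne him) ih

theorem HasIntersectionNumbers.card_le_card_dist_ne_sq (h : HasIntersectionNumbers Γ) {i m : ℕ}
    (hi : (Γ.distanceGraph i).Connected) (him : i ≠ m) (hm : m ≠ 0) (x : V) :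
    Fintype.card V ≤ #{w | Γ.dist x w ≠ m} ^ 2 := by
  classical
  have cover : univ ⊆ ({v | Γ.dist x v ≠ m} : Finset V).biUnion fun v => {w | Γ.dist v w ≠ m} := by
    intro w _
    obtain ⟨v, hxv, hvw⟩ := h.exists_dist_ne_dist_ne hi him hm x w
    exact mem_biUnion.2 ⟨v, by simpa using hxv, by simpa using hvw⟩
  rw [sq]
  exact (card_le_card cover).trans (card_biUnion_le_card_mul _ _ _ fun v _ =>
    (h.card_filter_dist_congr (· ≠ m) v x).le)

end DistanceGraph

section MaxDistanceClass

variable {V : Type*} {Γ : SimpleGraph V}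

theorem bddAbove_ncard_sphere [Finite V] :
    BddAbove {m : ℕ | ∃ (v : V) (i : ℕ), {w | Γ.dist v w = i}.ncard = m} :=
  ⟨Nat.card V, by rintro _ ⟨v, i, rfl⟩; exact Set.ncard_le_card _⟩

variable [Fintype V]

theorem card_sphere_le_maxDistanceClass (x : V) (i : ℕ) :
    #{w | Γ.dist x w = i} ≤ Γ.maxDistanceClass :=
  le_csSup bddAbove_ncard_sphere ⟨x, i, by rw [← Set.ncard_coe_finset, coe_filter_univ]⟩

theorem exists_card_sphere_eq_maxDistanceClass [Nonempty V] (Γ : SimpleGraph V) :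
    ∃ (x : V) (i : ℕ), #{w | Γ.dist x w = i} = Γ.maxDistanceClass := by
  obtain ⟨x, i, hxi⟩ := Nat.sSup_mem
    (s := {m : ℕ | ∃ (v : V) (i : ℕ), {w | Γ.dist v w = i}.ncard = m})
    ⟨_, Classical.arbitrary V, 0, rfl⟩ bddAbove_ncard_sphere
  exact ⟨x, i, by rw [← Set.ncard_coe_finset, coe_filter_univ]; exact hxi⟩

theorem maxDistanceClass_lt_card [Nontrivial V] (hc : Γ.Connected) :
    Γ.maxDistanceClass < Fintype.card V := by
  obtain ⟨x, i, hxi⟩ := exists_card_sphere_eq_maxDistanceClass Γ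
  obtain ⟨z, hz⟩ : ∃ z, Γ.dist x z ≠ i := by
    by_contra! hall
    obtain ⟨y, hy⟩ := exists_ne x
    exact hy (hc.dist_eq_zero_iff.1 (by rw [hall y, ← hall x, dist_self])).symm
  rw [← hxi]
  exact card_lt_univ_of_notMem (x := z) (by simpa using hz)

theorem card_sub_maxDistanceClass_le_card_dist_ne (x : V) (i : ℕ) :
    Fintype.card V - Γ.maxDistanceClass ≤ #{w | Γ.dist x w ≠ i} := by
  have hsplit := card_filter_add_card_filter_not (s := (univ : Finset V)) (Γ.dist x · = i)
  have := card_sphere_le_maxDistanceClass (Γ := Γ) x i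
  rw [card_univ] at hsplit
  lia

theorem exists_card_le_card_distinguishers_add_maxDistanceClass (x : V) :
    ∃ y, Fintype.card V ≤ #(distinguishers Γ x y) + Γ.maxDistanceClass := by
  classical
  by_contra! hsmall
  have double_count := card_mul_le_card_mul (s := univ) (t := univ)
    (m := Fintype.card V - Γ.maxDistanceClass) (n := Fintype.card V - Γ.maxDistanceClass - 1)
    (fun z y => z ∈ distinguishers Γ x y)
    (fun z _ => by
      simpa only [bipartiteAbove, mem_distinguishers, dist_comm (v := z), ne_comm] using
        card_sub_maxDistanceClass_le_card_dist_ne (Γ := Γ) z (Γ.dist z x))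
    fun y _ => by
      have := hsmall y
      rw [bipartiteBelow, filter_univ_mem]
      lia
  have := Nat.le_of_mul_le_mul_left double_count (card_pos.2 ⟨x, mem_univ x⟩)
  have := hsmall x
  lia

end MaxDistanceClass

theorem distanceGraph_dist_connected {V : Type*} [Finite V] {Γ : SimpleGraph V}
    (hprim : Γ.IsPrimitive) (hc : Γ.Connected) {a b : V} (hab : a ≠ b) :
    (Γ.distanceGraph (Γ.dist a b)).Connected :=
  hprim _ (hc.pos_dist_of_ne hab) (dist_le_diam_of_connected hc a b)

section Primitive

variable {V : Type*} [Fintype V] {Γ : SimpleGraph V}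

theorem diam_lt_card_of_connected (hc : Γ.Connected) : Γ.diam < Fintype.card V := by
  have := hc.nonempty
  obtain ⟨x, y, hxy⟩ := Γ.exists_dist_eq_diam
  obtain ⟨p, hp, hlength⟩ := hc.exists_path_of_dist x y
  rw [← hxy, ← hlength]
  exact hp.length_lt

theorem HasIntersectionNumbers.card_le_diam_mul_add_maxDistanceClass
    (h : HasIntersectionNumbers Γ) (hc : Γ.Connected) (hprim : Γ.IsPrimitive) {a b : V}
    (hab : a ≠ b) :
    Fintype.card V ≤ Γ.diam * #(distinguishers Γ a b) + Γ.maxDistanceClass := by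
  obtain ⟨y, hy⟩ := exists_card_le_card_distinguishers_add_maxDistanceClass (Γ := Γ) a
  have hconn := distanceGraph_dist_connected hprim hc hab
  calc Fintype.card V ≤ #(distinguishers Γ a y) + Γ.maxDistanceClass := hy
    _ ≤ (Γ.distanceGraph (Γ.dist a b)).dist a y * #(distinguishers Γ a b) +
        Γ.maxDistanceClass := by gcongr; exact h.card_distinguishers_le_dist_mul hconn a y
    _ ≤ Γ.diam * #(distinguishers Γ a b) + Γ.maxDistanceClass := by
        gcongr; exact h.dist_distanceGraph_le_diam hc hconn a y

theorem HasIntersectionNumbers.card_le_card_sub_maxDistanceClass_sq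
    (h : HasIntersectionNumbers Γ) (hc : Γ.Connected) (hprim : Γ.IsPrimitive) (hd : 2 ≤ Γ.diam) :
    Fintype.card V ≤ (Fintype.card V - Γ.maxDistanceClass) ^ 2 := by
  have := hc.nonempty
  obtain ⟨x, m, hxm⟩ := exists_card_sphere_eq_maxDistanceClass Γ
  obtain rfl | hm := eq_or_ne m 0
  · have hone : Γ.maxDistanceClass = 1 := by
      rw [← hxm, card_eq_one]
      exact ⟨x, by ext; simp [hc.dist_eq_zero_iff, eq_comm]⟩
    obtain ⟨k, hk⟩ := Nat.exists_eq_add_of_lt (hd.trans_lt (diam_lt_card_of_connected hc))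
    rw [hone, hk, Nat.add_sub_cancel]
    nlinarith
  · obtain ⟨i, hi_pos, hi_le, him⟩ : ∃ i, 0 < i ∧ i ≤ Γ.diam ∧ i ≠ m := by
      by_cases h1 : m = 1
      · exact ⟨2, two_pos, hd, by lia⟩
      · exact ⟨1, one_pos, by lia, Ne.symm h1⟩
    have hcompl : #{w | Γ.dist x w ≠ m} = Fintype.card V - Γ.maxDistanceClass := by
      rw [← hxm, ← card_univ, ← card_filter_add_card_filter_not (s := univ) (Γ.dist x · = m),
        Nat.add_sub_cancel_left]
    exact hcompl ▸ h.card_le_card_dist_ne_sq (hprim i hi_pos hi_le) him hm x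

theorem HasIntersectionNumbers.card_le_four_mul_card_distinguishers_sq
    (h : HasIntersectionNumbers Γ) (hc : Γ.Connected) (hprim : Γ.IsPrimitive) (hd : 2 ≤ Γ.diam)
    {a b : V} (hab : a ≠ b) : Fintype.card V ≤ 4 * #(distinguishers Γ a b) ^ 2 := by
  have hconn := distanceGraph_dist_connected hprim hc hab
  by_cases hdiam : ∀ x y, (Γ.distanceGraph (Γ.dist a b)).dist x y ≤ 2
  · obtain ⟨y, hy⟩ := exists_card_le_card_distinguishers_add_maxDistanceClass (Γ := Γ) a
    calc Fintype.card V ≤ (Fintype.card V - Γ.maxDistanceClass) ^ 2 :=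
          h.card_le_card_sub_maxDistanceClass_sq hc hprim hd
      _ ≤ #(distinguishers Γ a y) ^ 2 := by gcongr; lia
      _ ≤ (2 * #(distinguishers Γ a b)) ^ 2 := by
          gcongr
          exact (h.card_distinguishers_le_dist_mul hconn a y).trans
            (Nat.mul_le_mul_right _ (hdiam a y))
      _ = 4 * #(distinguishers Γ a b) ^ 2 := by ring
  · push Not at hdiam
    obtain ⟨x, w, hxw⟩ := hdiam
    obtain ⟨y, hxy, -⟩ := exists_dist_eq_of_le_dist hconn (i := 3) hxw
    have spheres_le := card_sphere_add_card_sphere_le_card_distinguishers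
      (hc.pos_dist_of_ne hab).ne' hxy.ge
    have distinguishers_le := h.card_distinguishers_le_dist_mul hconn x y
    rw [hxy] at distinguishers_le
    rw [h.card_filter_dist_congr (· = Γ.dist a b) x a,
      h.card_filter_dist_congr (· = Γ.dist a b) y a] at spheres_le
    have card_le := h.card_le_card_sphere_mul hc hab hconn
    nlinarith

theorem HasIntersectionNumbers.metricDimension_lt_sqrt (h : HasIntersectionNumbers Γ)
    (hc : Γ.Connected) (hprim : Γ.IsPrimitive) (hd : 2 ≤ Γ.diam) :
    (Γ.metricDimension : ℝ) <
      4 * √(Fintype.card V) * Real.log (Fintype.card V) := by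
  have hcard : 1 < Fintype.card V := by linarith [diam_lt_card_of_connected hc]
  have := Fintype.one_lt_card_iff_nontrivial.1 hcard
  have half_sqrt_le : ∀ a b, a ≠ b → √(Fintype.card V) / 2 ≤ #(distinguishers Γ a b) := by
    intro a b hab
    rw [div_le_iff₀' two_pos, Real.sqrt_le_left (by positivity), mul_pow]
    norm_num
    exact_mod_cast h.card_le_four_mul_card_distinguishers_sq hc hprim hd hab
  have hn : (1 : ℝ) ≤ Fintype.card V := mod_cast hcard.le
  set n : ℝ := (Fintype.card V : ℝ)
  have hsqrt_le : √n ≤ n := Real.sqrt_le_iff.2 ⟨by linarith, le_self_pow₀ hn two_ne_zero⟩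
  calc (Γ.metricDimension : ℝ) < 2 * n * Real.log n / (√n / 2) :=
        metricDimension_lt_of_le_card_distinguishers (by positivity) (by gcongr) half_sqrt_le
    _ = 4 * (n / √n) * Real.log n := by ring
    _ = 4 * √n * Real.log n := by rw [Real.div_sqrt]

theorem HasIntersectionNumbers.metricDimension_lt_diam_mul (h : HasIntersectionNumbers Γ)
    (hc : Γ.Connected) (hprim : Γ.IsPrimitive) (hd : 2 ≤ Γ.diam) :
    (Γ.metricDimension : ℝ) <
      2 * Γ.diam * (Fintype.card V / (Fintype.card V - Γ.maxDistanceClass)) *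
        Real.log (Fintype.card V) := by
  have hcard : 1 < Fintype.card V := by linarith [diam_lt_card_of_connected hc]
  have := Fintype.one_lt_card_iff_nontrivial.1 hcard
  have hM : (0 : ℝ) < Fintype.card V - Γ.maxDistanceClass :=
    sub_pos.2 (mod_cast maxDistanceClass_lt_card hc)
  have hdiam : (2 : ℝ) ≤ Γ.diam := mod_cast hd
  refine (metricDimension_lt_of_le_card_distinguishers
    (D := (Fintype.card V - Γ.maxDistanceClass) / Γ.diam) (by positivity) ?_
    fun a b hab => ?_).trans_eq ?_
  · gcongr
    exact sub_le_self _ (Nat.cast_nonneg _)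
  · rw [div_le_iff₀' (by linarith), sub_le_iff_le_add]
    exact_mod_cast h.card_le_diam_mul_add_maxDistanceClass hc hprim hab
  · field_simp

end Primitive

end MetricDimension

theorem mainTheorem11 {V : Type*} [Fintype V] (Γ : SimpleGraph V) (t : ℕ)
    (hreg : Γ.IsDistanceRegular) (hdiam : 4 ≤ Γ.diam) (hanti : Γ.IsAntipodal t)
    (hprim : hanti.foldedGraph.IsPrimitive) (hfdiam : 2 ≤ hanti.foldedGraph.diam) :
    (Γ.metricDimension : ℝ) <
        ((t : ℝ) - 1) *
          (4 * Real.sqrt ((Fintype.card V : ℝ) / (t : ℝ)) *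
            Real.log ((Fintype.card V : ℝ) / (t : ℝ)) + 1) ∧
      (Γ.metricDimension : ℝ) <
        ((t : ℝ) - 1) *
          (2 * (hanti.foldedGraph.diam : ℝ) *
            ((Fintype.card V : ℝ) /
              ((Fintype.card V : ℝ) - (t : ℝ) * (hanti.foldedGraph.maxDistanceClass : ℝ))) *
            Real.log ((Fintype.card V : ℝ) / (t : ℝ)) + 1) := by
  have h := MetricDimension.hasIntersectionNumbers_of_isDistanceRegular hreg
  have hc : Γ.Connected := hreg.1
  have hd : 2 ≤ Γ.diam := by lia
  have hg := h.geodesicsExtend hc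
  let _ : Fintype (Quotient hanti.setoid) := Fintype.ofFinite _
  have ht : (t : ℝ) ≠ 0 := by
    have := MetricDimension.two_le_of_isAntipodal hanti hc (by lia)
    exact_mod_cast (by lia : t ≠ 0)
  have hcard : (Fintype.card V : ℝ) = Fintype.card (Quotient hanti.setoid) * t :=
    mod_cast MetricDimension.card_eq_card_quotient_mul hanti
  have hf := h.foldedGraph hanti hc hd
  have hfc := MetricDimension.foldedGraph_connected hanti hc hd
  rw [hcard, mul_comm (t : ℝ), ← sub_mul, mul_div_mul_right _ _ ht, mul_div_cancel_right₀ _ ht]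
  exact ⟨MetricDimension.metricDimension_lt_of_metricDimension_foldedGraph_lt hanti hg hc hd
      (hf.metricDimension_lt_sqrt hfc hprim hfdiam),
    MetricDimension.metricDimension_lt_of_metricDimension_foldedGraph_lt hanti hg hc hd
      (hf.metricDimension_lt_diam_mul hfc hprim hfdiam)⟩
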